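/- A topological space $X$ is \emph{Menger} if for every sequence $(\mathcal U_n)_{n\in\omega}$ of open covers of $X$ there are finite sets $\mathcal V_n\subseteq\mathcal U_n$ such that $\bigcup_{n\in\omega}\bigcup\mathcal V_n = X$. A space is \emph{analytic} if it is empty or a continuous image of the Baire space $\omega^\omega$. Let $\mathcal P(\omega)$ be identified with the Cantor space $\{0,1\}^\omega$ (product topology). Proposition. Let $G$ be an analytic Hausdorff topological group and let $M$ be a non-empty subset of $G$ which is Menger in the subspace topology. If $G\setminus M$ is a subgroup of $G$, then $G$ is $\sigma$-compact, and, if $G$ is uncountable, $M$ contains a homeomorphic copy of $\mathcal P(\omega)$. -/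

import Mathlib

/-- A topological space `X` is Menger if for every sequence `𝒰 0, 𝒰 1, …` of open covers of `X`
there are finite subfamilies `𝒱 n ⊆ 𝒰 n` such that the sets `⋃₀ 𝒱 n` cover `X`. -/
def IsMengerSpace (X : Type*) [TopologicalSpace X] : Prop :=
  ∀ 𝒰 : ℕ → Set (Set X),
    (∀ n, (∀ U ∈ 𝒰 n, IsOpen U) ∧ ⋃₀ (𝒰 n) = Set.univ) →
    ∃ 𝒱 : ℕ → Set (Set X),
      (∀ n, 𝒱 n ⊆ 𝒰 n ∧ (𝒱 n).Finite) ∧ ⋃ n, ⋃₀ (𝒱 n) = Set.univ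

/-- A topological space is analytic if it is empty or a continuous image of the Baire space
`ℕ → ℕ`. -/
def IsAnalyticSpace (X : Type*) [TopologicalSpace X] : Prop :=
  MeasureTheory.AnalyticSet (Set.univ : Set X)

/-- The subset `M` contains a homeomorphic copy of the Cantor space `P(ω) = {0,1}^ω`. -/
def ContainsCantorSet {X : Type*} [TopologicalSpace X] (M : Set X) : Prop :=
  ∃ K : Set X, K ⊆ M ∧ Nonempty (K ≃ₜ (ℕ → Bool))

open Set Filter Topology

/-! ### Selections in Menger spaces and the Menger game -/

section Menger

variable {X Y : Type*}

/-! Let `H` be the subgroup complementary to `M` and fix `a` in `M`. As `a ∉ H`, the coset `aH` lies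
in `M`, so `G = M ∪ a⁻¹M` is a union of two continuous images of a Menger space, hence Menger. An
analytic regular Menger space is σ-compact (`IsMengerSpace.sigmaCompactSpace`): otherwise the first
player could win the Menger game, against Hurewicz (`IsMengerSpace.exists_play`). An uncountable `G`
contains a Cantor set by Suslin. Either a cylinder of it lies in `M`, or `H` is dense in it. In the
latter case a re-embedding sends the finitely supported points into `H`, the Menger property of `M`
yields a smaller Cantor set inside `H`, and translation by `a` moves it into `M`. -/

theorem IsMengerSpace.exists_finite_subfamilies [TopologicalSpace X]
    [TopologicalSpace Y] (hY : IsMengerSpace Y) {f : Y → X}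
    (hf : Continuous f) (𝒰 : ℕ → Set (Set X))
    (h𝒰 : ∀ n, (∀ U ∈ 𝒰 n, IsOpen U) ∧ ⋃₀ (𝒰 n) = univ) :
    ∃ 𝒱 : ℕ → Set (Set X), (∀ n, 𝒱 n ⊆ 𝒰 n ∧ (𝒱 n).Finite) ∧ range f ⊆ ⋃ n, ⋃₀ (𝒱 n) := by
  obtain ⟨𝒱, h𝒱, hcov⟩ := hY (fun n => preimage f '' 𝒰 n) (fun n => by
    refine ⟨?_, ?_⟩
    · rintro _ ⟨U, hU, rfl⟩
      exact ((h𝒰 n).1 U hU).preimage hf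
    · rw [sUnion_image, ← preimage_iUnion₂, ← sUnion_eq_biUnion, (h𝒰 n).2, preimage_univ])
  have key : ∀ n, ∃ 𝒲 ⊆ 𝒰 n, 𝒲.Finite ∧ preimage f '' 𝒲 = 𝒱 n := fun n => by
    obtain ⟨𝒲, h1, h2, h3⟩ := exists_subset_image_finite_and.1
      ⟨𝒱 n, (h𝒱 n).1, (h𝒱 n).2, (rfl : 𝒱 n = 𝒱 n)⟩
    exact ⟨𝒲, h1, h2, h3.symm⟩
  choose 𝒲 hsub hfin himg using key
  refine ⟨𝒲, fun n => ⟨hsub n, hfin n⟩, ?_⟩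
  rintro _ ⟨y, rfl⟩
  have hy : y ∈ ⋃ n, ⋃₀ (𝒱 n) := hcov ▸ mem_univ y
  obtain ⟨n, V, hV, hyV⟩ := mem_iUnion.1 hy
  rw [← himg n] at hV
  obtain ⟨U, hU, rfl⟩ := hV
  exact mem_iUnion.2 ⟨n, U, hU, hyV⟩

theorem IsMengerSpace.of_range_union_range_eq_univ [TopologicalSpace X]
    [TopologicalSpace Y] (hY : IsMengerSpace Y) {f g : Y → X}
    (hf : Continuous f) (hg : Continuous g) (h : range f ∪ range g = univ) :
    IsMengerSpace X := by
  intro 𝒰 h𝒰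
  obtain ⟨𝒱, h𝒱, hfc⟩ := hY.exists_finite_subfamilies hf 𝒰 h𝒰
  obtain ⟨𝒲, h𝒲, hgc⟩ := hY.exists_finite_subfamilies hg 𝒰 h𝒰
  refine ⟨fun n => 𝒱 n ∪ 𝒲 n, fun n => ⟨union_subset (h𝒱 n).1 (h𝒲 n).1,
    (h𝒱 n).2.union (h𝒲 n).2⟩, ?_⟩
  rw [eq_univ_iff_forall]
  intro x
  simp only [sUnion_union, iUnion_union_distrib]
  exact union_subset_union hfc hgc (h ▸ mem_univ x)

/-- For increasing countable open covers the selection in a Menger space can be made by a strictly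
increasing function. -/
theorem IsMengerSpace.exists_strictMono [TopologicalSpace X] (hX : IsMengerSpace X)
    (A : ℕ → ℕ → Set X)
    (hopen : ∀ n k, IsOpen (A n k)) (hmono : ∀ n, Monotone (A n))
    (hcov : ∀ n x, ∃ k, x ∈ A n k) :
    ∃ g : ℕ → ℕ, StrictMono g ∧ ∀ x, ∃ n, x ∈ A n (g n) := by
  obtain ⟨𝒱, h𝒱, hc⟩ := hX (fun n => range (A n)) (fun n => by
    refine ⟨?_, ?_⟩
    · rintro _ ⟨k, rfl⟩
      exact hopen n k
    · rw [sUnion_range, eq_univ_iff_forall]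
      exact fun x => mem_iUnion.2 (hcov n x))
  have key : ∀ n, ∃ b, ⋃₀ (𝒱 n) ⊆ A n b := fun n => by
    choose! c hc using (h𝒱 n).1
    obtain ⟨b, hb⟩ := ((h𝒱 n).2.image c).bddAbove
    refine ⟨b, sUnion_subset fun V hV => ?_⟩
    rw [← hc hV]
    exact hmono n (hb (mem_image_of_mem c hV))
  choose b hb using key
  -- Partial sums dominate `b`; the `+ 1` makes them strictly increasing.
  refine ⟨fun n => ∑ i ∈ Finset.range (n + 1), (b i + 1), strictMono_nat_of_lt_succ fun n => ?_,
    fun x => ?_⟩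
  · rw [Finset.sum_range_succ _ (n + 1)]
    omega
  · obtain ⟨n, hn⟩ := mem_iUnion.1 (show x ∈ ⋃ n, ⋃₀ (𝒱 n) from hc ▸ mem_univ x)
    refine ⟨n, hmono n ?_ (hb n hn)⟩
    simp only [Finset.sum_range_succ]
    omega

open PiNat (res)

/-- The set of points covered in the course of a play with history `s`, most recent move first. -/
def playCover (W : List ℕ → ℕ → Set X) : List ℕ → Set X
  | [] => ∅
  | k :: s => W s k ∪ playCover W s

theorem isOpen_playCover [TopologicalSpace X] {W : List ℕ → ℕ → Set X}
    (hW : ∀ s k, IsOpen (W s k)) :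
    ∀ s, IsOpen (playCover W s)
  | [] => isOpen_empty
  | k :: s => (hW s k).union (isOpen_playCover hW s)

theorem playCover_cons_mono {W : List ℕ → ℕ → Set X} (hW : ∀ s, Monotone (W s)) (s : List ℕ) :
    Monotone fun k => playCover W (k :: s) :=
  fun _ _ h => union_subset_union_left _ (hW s h)

/-- The points covered by the move `k` after every history of length at most `n` with moves
below `k`. -/
def robustCover (W : List ℕ → ℕ → Set X) (n k : ℕ) : Set X :=
  {x | ∀ s : List ℕ, s.length ≤ n → (∀ a ∈ s, a < k) → x ∈ playCover W (k :: s)}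

theorem finite_lists_length_le_forall_lt (n k : ℕ) :
    {s : List ℕ | s.length ≤ n ∧ ∀ a ∈ s, a < k}.Finite := by
  induction n with
  | zero =>
    refine (finite_singleton ([] : List ℕ)).subset ?_
    rintro s ⟨hs, -⟩
    simpa using hs
  | succ n ih =>
    refine ((finite_singleton ([] : List ℕ)).union
      (Finite.image2 List.cons (finite_Iio k) ih)).subset ?_
    rintro (_ | ⟨a, s⟩) ⟨hs, hlt⟩
    · exact Or.inl rfl
    · refine Or.inr ⟨a, hlt a (by simp), s, ⟨by simpa using hs, fun b hb => hlt b (by simp [hb])⟩,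
        rfl⟩

theorem isOpen_robustCover [TopologicalSpace X] {W : List ℕ → ℕ → Set X}
    (hW : ∀ s k, IsOpen (W s k)) (n k : ℕ) :
    IsOpen (robustCover W n k) := by
  have : robustCover W n k =
      ⋂ s ∈ {s : List ℕ | s.length ≤ n ∧ ∀ a ∈ s, a < k}, playCover W (k :: s) := by
    ext x
    simp [robustCover]
  rw [this]
  exact (finite_lists_length_le_forall_lt n k).isOpen_biInter
    fun s _ => isOpen_playCover hW _

/-- Consider the earliest move `≥ k` in `s`: the history before it is one tested by `robustCover W n
k`, and the larger move covers at least as much as `k`. -/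
theorem forall_lt_or_mem_playCover {W : List ℕ → ℕ → Set X} (hW : ∀ s, Monotone (W s))
    {n k : ℕ} {x : X} (hx : x ∈ robustCover W n k) :
    ∀ s : List ℕ, s.length ≤ n + 1 → (∀ a ∈ s, a < k) ∨ x ∈ playCover W s
  | [], _ => Or.inl (by simp)
  | a :: s, hs => by
    have hs' : s.length ≤ n := by simpa using hs
    rcases forall_lt_or_mem_playCover hW hx s (by omega) with h | h
    · rcases lt_or_ge a k with hak | hak
      · exact Or.inl (by simpa [hak] using h)
      · exact Or.inr (playCover_cons_mono hW s hak (hx s hs' h))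
    · exact Or.inr (Or.inr h)

theorem robustCover_mono {W : List ℕ → ℕ → Set X} (hW : ∀ s, Monotone (W s)) (n : ℕ) :
    Monotone (robustCover W n) := by
  intro k k' hk x hx s hs _
  rcases forall_lt_or_mem_playCover hW hx s (by omega) with h | h
  · exact playCover_cons_mono hW s hk (hx s hs h)
  · exact Or.inr h

theorem exists_mem_robustCover {W : List ℕ → ℕ → Set X} (hW : ∀ s, Monotone (W s))
    (hcov : ∀ s x, ∃ k, x ∈ W s k) (n : ℕ) (x : X) : ∃ k, x ∈ robustCover W n k := by
  induction n with
  | zero =>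
    obtain ⟨k, hk⟩ := hcov [] x
    refine ⟨k, fun s hs _ => ?_⟩
    obtain rfl : s = [] := by simpa using hs
    exact Or.inl hk
  | succ n ih =>
    obtain ⟨k, hk⟩ := ih
    choose c hc using fun s => hcov s x
    obtain ⟨b, hb⟩ := ((finite_lists_length_le_forall_lt (n + 1) k).image c).bddAbove
    refine ⟨max b k, fun s hs _ => ?_⟩
    rcases forall_lt_or_mem_playCover hW hk s hs with h | h
    · exact Or.inl (hW s ((hb (mem_image_of_mem c ⟨hs, h⟩)).trans (le_max_left _ _)) (hc s))
    · exact Or.inr h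

theorem exists_mem_of_mem_playCover_res {W : List ℕ → ℕ → Set X} {g : ℕ → ℕ} {x : X} :
    ∀ {n : ℕ}, x ∈ playCover W (res g n) → ∃ m, x ∈ W (res g m) (g m)
  | 0, h => h.elim
  | n + 1, h => h.elim (fun h => ⟨n, h⟩) exists_mem_of_mem_playCover_res

/-- Hurewicz: in a Menger space the first player has no winning strategy in the Menger game. Here
the moves of the first player are increasing sequences of open sets that cover the space, and
`W s` is the move after the replies `s`, listed with the most recent reply first. -/
theorem IsMengerSpace.exists_play [TopologicalSpace X] (hX : IsMengerSpace X)
    (W : List ℕ → ℕ → Set X)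
    (hopen : ∀ s k, IsOpen (W s k)) (hmono : ∀ s, Monotone (W s))
    (hcov : ∀ s x, ∃ k, x ∈ W s k) :
    ∃ g : ℕ → ℕ, ∀ x, ∃ n, x ∈ W (res g n) (g n) := by
  obtain ⟨g, hg, h⟩ := hX.exists_strictMono (robustCover W) (isOpen_robustCover hopen)
    (robustCover_mono hmono) (exists_mem_robustCover hmono hcov)
  -- Strict growth of `g` puts `res g n` among the histories tested by `robustCover W n (g n)`.
  have hlt : ∀ m n, m ≤ n → ∀ a ∈ res g m, a < g n := by
    intro m
    induction m with
    | zero => simp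
    | succ m ih =>
      intro n hn a ha
      rw [PiNat.res_succ, List.mem_cons] at ha
      rcases ha with rfl | ha
      · exact hg hn
      · exact ih n (by omega) a ha
  refine ⟨g, fun x => ?_⟩
  obtain ⟨n, hn⟩ := h x
  exact exists_mem_of_mem_playCover_res (n := n + 1)
    (hn (res g n) (PiNat.res_length g n).le (hlt n n le_rfl))

end Menger

/-! ### Compactness from increasing covers -/

/-- By regularity every point has a neighbourhood whose closure meets `closure A` in a finitely
covered set; Lindelöf leaves countably many, and their partial unions serve as `W`. -/
theorem isCompact_closure_of_forall_cover {X : Type*} [TopologicalSpace X] [RegularSpace X]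
    [LindelofSpace X] {A : Set X}
    (h : ∀ W : ℕ → Set X, (∀ k, IsOpen (W k)) → Monotone W → (∀ x, ∃ k, x ∈ W k) →
      ∃ k, A ⊆ closure (W k)) :
    IsCompact (closure A) := by
  refine isCompact_of_finite_subcover fun {ι} U hU hAU => ?_
  have hO : ∀ x, ∃ O, IsOpen O ∧ x ∈ O ∧
      ∃ t : Finset ι, closure O ∩ closure A ⊆ ⋃ i ∈ t, U i := by
    intro x
    by_cases hx : x ∈ closure A
    · obtain ⟨i, hi⟩ := mem_iUnion.1 (hAU hx)
      obtain ⟨C, hC, hCc, hCU⟩ := exists_mem_nhds_isClosed_subset ((hU i).mem_nhds hi)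
      refine ⟨interior C, isOpen_interior, mem_interior_iff_mem_nhds.2 hC, {i}, ?_⟩
      simp only [Finset.mem_singleton, iUnion_iUnion_eq_left]
      exact inter_subset_left.trans ((closure_minimal interior_subset hCc).trans hCU)
    · obtain ⟨C, hC, hCc, hCU⟩ :=
        exists_mem_nhds_isClosed_subset (isClosed_closure.isOpen_compl.mem_nhds hx)
      refine ⟨interior C, isOpen_interior, mem_interior_iff_mem_nhds.2 hC, ∅, ?_⟩
      exact fun y hy => (hCU (closure_minimal interior_subset hCc hy.1) hy.2).elim
  choose O hOo hxO t ht using hO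
  rcases isEmpty_or_nonempty X with hX | hX
  · exact ⟨∅, fun x => (hX.false x).elim⟩
  obtain ⟨s, hs, hsU⟩ := LindelofSpace.elim_nhds_subcover O fun x => (hOo x).mem_nhds (hxO x)
  have hsne : s.Nonempty := by
    rw [nonempty_iff_ne_empty]
    rintro rfl
    exact empty_ne_univ (by simpa using hsU)
  obtain ⟨e, rfl⟩ := hs.exists_eq_range hsne
  obtain ⟨k, hk⟩ := h (fun k => ⋃ i ∈ Finset.range k, O (e i))
    (fun k => isOpen_biUnion fun i _ => hOo _)
    (fun k k' hk => biUnion_subset_biUnion_left (by simpa using hk))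
    (fun x => by
      have hx : x ∈ ⋃ y ∈ range e, O y := hsU ▸ mem_univ x
      simp only [mem_range, iUnion_exists, iUnion_iUnion_eq', mem_iUnion] at hx
      obtain ⟨i, hi⟩ := hx
      exact ⟨i + 1, mem_biUnion (by simp) hi⟩)
  classical
  refine ⟨(Finset.range k).biUnion fun i => t (e i), fun x hx => ?_⟩
  have hx' := closure_minimal hk isClosed_closure hx
  rw [Finset.closure_biUnion] at hx'
  obtain ⟨i, hi, hxi⟩ := mem_iUnion₂.1 hx'
  obtain ⟨j, hj, hxj⟩ := mem_iUnion₂.1 (ht (e i) ⟨hxi, hx⟩)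
  exact mem_iUnion₂.2 ⟨j, Finset.mem_biUnion.2 ⟨i, hi, hj⟩, hxj⟩

/-! ### Schemes of cylinders in the Baire space -/

section BaireSchemes

open PiNat (cylinder res)

theorem exists_cylinder_subset {z : ℕ → ℕ} {U : Set (ℕ → ℕ)} (hU : IsOpen U) (hz : z ∈ U) (m : ℕ) :
    ∃ n, m < n ∧ cylinder z n ⊆ U := by
  obtain ⟨_, ⟨y, n, rfl⟩, hzy, hyU⟩ :=
    (PiNat.isTopologicalBasis_cylinders fun _ => ℕ).exists_subset_of_mem_open hz hU
  rw [← PiNat.mem_cylinder_iff_eq.1 hzy] at hyU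
  exact ⟨max n (m + 1), by omega, (PiNat.cylinder_anti z (le_max_left _ _)).trans hyU⟩

theorem diag_mem_cylinder {α : Type*} {z : ℕ → ℕ → α} {l : ℕ → ℕ} (hl : StrictMono l)
    (hz : ∀ m, z (m + 1) ∈ cylinder (z m) (l m)) (m : ℕ) :
    (fun i => z (i + 1) i) ∈ cylinder (z m) (l m) := by
  have key : ∀ m n, m ≤ n → ∀ i < l m, z n i = z m i := by
    intro m n hmn
    induction n, hmn using Nat.le_induction with
    | base => exact fun _ _ => rfl
    | succ n hmn ih =>
      intro i hi
      rw [← ih i hi]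
      exact hz n i (hi.trans_le (hl.monotone hmn))
  intro i hi
  rcases le_total m (i + 1) with h | h
  · exact key m (i + 1) h i hi
  · exact (key (i + 1) m h i (i.lt_succ_self.trans_le (hl.id_le _))).symm

/-- Moving along a tree of cylinders with increasing depth leads to a limit point. -/
theorem limit_mem_cylinder {α : Type*} {st : List α → (ℕ → ℕ) × ℕ}
    (hst : ∀ a s, (st s).2 < (st (a :: s)).2 ∧ (st (a :: s)).1 ∈ cylinder (st s).1 (st s).2)
    (g : ℕ → α) (m : ℕ) :
    (fun i => (st (res g (i + 1))).1 i) ∈ cylinder (st (res g m)).1 (st (res g m)).2 :=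
  diag_mem_cylinder (z := fun m => (st (res g m)).1) (l := fun m => (st (res g m)).2)
    (strictMono_nat_of_lt_succ fun _ => (hst _ _).1) (fun _ => (hst _ _).2) m

theorem IsMengerSpace.sigmaCompactSpace {X : Type*} [TopologicalSpace X] [RegularSpace X]
    (hX : IsMengerSpace X) {f : (ℕ → ℕ) → X} (hf : Continuous f) (hrange : range f = univ) :
    SigmaCompactSpace X := by
  by_contra hns
  have : LindelofSpace X := ⟨hrange ▸ isLindelof_range hf⟩
  set B : Set (ℕ → ℕ) :=
    {z | ∃ U, IsOpen U ∧ z ∈ U ∧ ∃ S, IsSigmaCompact S ∧ f '' U ⊆ S}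
  obtain ⟨SB, hSB, hBS⟩ : ∃ S, IsSigmaCompact S ∧ f '' B ⊆ S := by
    refine (HereditarilyLindelofSpace.isLindelof B).induction_on
      (p := fun U => ∃ S, IsSigmaCompact S ∧ f '' U ⊆ S) ?_ ?_ ?_
    · rintro s t hst ⟨S, hS, htS⟩
      exact ⟨S, hS, (image_mono hst).trans htS⟩
    · intro 𝒮 h𝒮 h
      choose! S hS hsS using h
      refine ⟨⋃ s ∈ 𝒮, S s, isSigmaCompact_biUnion h𝒮 hS, ?_⟩
      rw [image_sUnion, sUnion_image]
      exact iUnion₂_mono hsS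
    · rintro z ⟨U, hU, hzU, hUS⟩
      exact ⟨U, mem_nhdsWithin_of_mem_nhds (hU.mem_nhds hzU), hUS⟩
  -- One round of a winning strategy: whatever `k` is answered, play passes to a subcylinder whose
  -- image misses `W k`. If no `W` worked, the image of `cylinder z n \ B` would have compact
  -- closure, forcing `z ∈ B`.
  have step : ∀ (z : (Bᶜ : Set (ℕ → ℕ))) (n : ℕ), ∃ W : ℕ → Set X, (∀ k, IsOpen (W k)) ∧
      Monotone W ∧ (∀ x, ∃ k, x ∈ W k) ∧ ∀ k, ∃ (z' : (Bᶜ : Set (ℕ → ℕ))) (n' : ℕ), n < n' ∧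
        z'.1 ∈ cylinder z.1 n ∧ ∀ y ∈ cylinder z'.1 n', f y ∉ W k := by
    rintro ⟨z, hz⟩ n
    by_contra! hcon
    have hcomp : IsCompact (closure (f '' (cylinder z n \ B))) := by
      refine isCompact_closure_of_forall_cover fun W hWo hWm hWc => ?_
      obtain ⟨k, hk⟩ := hcon W hWo hWm hWc
      refine ⟨k, ?_⟩
      rintro _ ⟨y, ⟨hyz, hyB⟩, rfl⟩
      by_contra hy
      obtain ⟨n', hn', hsub⟩ :=
        exists_cylinder_subset (isClosed_closure.isOpen_compl.preimage hf) hy n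
      obtain ⟨w, hw, hwW⟩ := hk ⟨y, hyB⟩ n' hn' hyz
      exact hsub hw (subset_closure hwW)
    refine hz ⟨cylinder z n, PiNat.isOpen_cylinder _ z n, PiNat.self_mem_cylinder z n,
      closure (f '' (cylinder z n \ B)) ∪ SB, ?_, ?_⟩
    · rw [union_eq_iUnion]
      exact isSigmaCompact_iUnion _ fun b => by cases b <;> simp [hSB, hcomp.isSigmaCompact]
    · rintro _ ⟨y, hy, rfl⟩
      by_cases hyB : y ∈ B
      · exact Or.inr (hBS (mem_image_of_mem f hyB))
      · exact Or.inl (subset_closure (mem_image_of_mem f ⟨hy, hyB⟩))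
  obtain ⟨z₀, hz₀⟩ : (Bᶜ : Set (ℕ → ℕ)).Nonempty := by
    rw [nonempty_compl]
    intro h
    refine hns (isSigmaCompact_univ_iff.1 ?_)
    rw [h, image_univ, hrange, univ_subset_iff] at hBS
    exact hBS ▸ hSB
  choose W hWo hWm hWc nz nn hlt hmem havoid using step
  let st : List ℕ → (Bᶜ : Set (ℕ → ℕ)) × ℕ :=
    List.foldr (fun k p => (nz p.1 p.2 k, nn p.1 p.2 k)) (⟨z₀, hz₀⟩, 0)
  obtain ⟨g, hg⟩ := hX.exists_play (fun s => W (st s).1 (st s).2) (fun _ => hWo _ _)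
    (fun _ => hWm _ _) (fun _ => hWc _ _)
  have hlim := limit_mem_cylinder (st := fun s => ((st s).1.1, (st s).2))
    (fun a s => ⟨hlt _ _ a, hmem _ _ a⟩) g
  obtain ⟨n, hn⟩ := hg (f fun i => (st (res g (i + 1))).1.1 i)
  exact havoid _ _ (g n) _ (hlim (n + 1)) hn

theorem eventually_res_eq {α : Type*} [TopologicalSpace α] [DiscreteTopology α] (x : ℕ → α)
    (n : ℕ) : ∀ᶠ y in 𝓝 x, res y n = res x n := by
  induction n with
  | zero => simp
  | succ n ih =>
    have h : ∀ᶠ y in 𝓝 x, y n = x n :=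
      (continuous_apply n).continuousAt.eventually (isOpen_discrete {x n} |>.mem_nhds rfl)
    filter_upwards [ih, h] with y h1 h2
    rw [PiNat.res_succ, PiNat.res_succ, h1, h2]

theorem continuous_comp_res {α β : Type*} [TopologicalSpace α] [DiscreteTopology α]
    [TopologicalSpace β] (F : List α → β) (n : ℕ) : Continuous fun x : ℕ → α => F (res x n) :=
  continuous_iff_continuousAt.2 fun x =>
    (continuousAt_const (y := F (res x n))).congr
      ((eventually_res_eq x n).mono fun _ hy => congrArg F hy.symm)

/-- Suslin: an uncountable continuous image of the Baire space contains a Cantor set. -/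
theorem exists_continuous_injective_of_not_countable_range {X : Type*} [TopologicalSpace X]
    [T2Space X] {f : (ℕ → ℕ) → X} (hf : Continuous f) (hrange : ¬ (range f).Countable) :
    ∃ φ : (ℕ → Bool) → X, Continuous φ ∧ Function.Injective φ := by
  set B : Set (ℕ → ℕ) := {z | ∃ U, IsOpen U ∧ z ∈ U ∧ (f '' U).Countable}
  have hBc : (f '' B).Countable := by
    refine (HereditarilyLindelofSpace.isLindelof B).induction_on
      (p := fun U => (f '' U).Countable) ?_ ?_ ?_
    · exact fun s t hst ht => ht.mono (image_mono hst)
    · intro 𝒮 h𝒮 h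
      rw [image_sUnion, sUnion_image]
      exact h𝒮.biUnion h
    · rintro z ⟨U, hU, hzU, hUS⟩
      exact ⟨U, mem_nhdsWithin_of_mem_nhds (hU.mem_nhds hzU), hUS⟩
  have step : ∀ (z : (Bᶜ : Set (ℕ → ℕ))) (n : ℕ),
      ∃ (z' : Bool → (Bᶜ : Set (ℕ → ℕ))) (n' : Bool → ℕ),
        (∀ b, n < n' b ∧ (z' b).1 ∈ cylinder z.1 n) ∧
        ∀ y ∈ cylinder (z' false).1 (n' false), ∀ w ∈ cylinder (z' true).1 (n' true),
          f y ≠ f w := by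
    rintro ⟨z, hz⟩ n
    -- A single value outside `B` would leave the cylinder with countable image, so `z ∈ B`.
    have hnt : (f '' (cylinder z n \ B)).Nontrivial := by
      rw [← not_subsingleton_iff]
      intro hss
      refine hz ⟨cylinder z n, PiNat.isOpen_cylinder _ z n, PiNat.self_mem_cylinder z n,
        (hss.countable.union hBc).mono ?_⟩
      rintro _ ⟨y, hy, rfl⟩
      by_cases hyB : y ∈ B
      · exact Or.inr (mem_image_of_mem f hyB)
      · exact Or.inl (mem_image_of_mem f ⟨hy, hyB⟩)
    obtain ⟨_, ⟨y, hy, rfl⟩, _, ⟨w, hw, rfl⟩, hne⟩ := hnt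
    obtain ⟨U, V, hU, hV, hyU, hwV, hUV⟩ := t2_separation hne
    obtain ⟨m, hm, hmU⟩ := exists_cylinder_subset (hU.preimage hf) hyU n
    obtain ⟨k, hk, hkV⟩ := exists_cylinder_subset (hV.preimage hf) hwV n
    refine ⟨fun b => cond b ⟨w, hw.2⟩ ⟨y, hy.2⟩, fun b => cond b k m, ?_, ?_⟩
    · rintro (_ | _)
      exacts [⟨hm, hy.1⟩, ⟨hk, hw.1⟩]
    · exact fun a ha b hb => hUV.ne_of_mem (hmU ha) (hkV hb)
  obtain ⟨z₀, hz₀⟩ : (Bᶜ : Set (ℕ → ℕ)).Nonempty := by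
    rw [nonempty_compl]
    intro h
    rw [h, image_univ] at hBc
    exact hrange hBc
  choose nz nn hnext hdisj using step
  let st : List Bool → (Bᶜ : Set (ℕ → ℕ)) × ℕ :=
    List.foldr (fun k p => (nz p.1 p.2 k, nn p.1 p.2 k)) (⟨z₀, hz₀⟩, 0)
  have hlim := limit_mem_cylinder (st := fun s => ((st s).1.1, (st s).2))
    (fun a s => hnext _ _ a)
  refine ⟨fun x => f fun i => (st (res x (i + 1))).1.1 i,
    hf.comp (continuous_pi fun i => continuous_comp_res (fun s => (st s).1.1 i) (i + 1)), ?_⟩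
  intro x y hxy
  refine PiNat.res_injective (funext fun n => ?_)
  induction n with
  | zero => rfl
  | succ n ih =>
    rw [PiNat.res_succ, PiNat.res_succ, ih]
    congr 1
    have hx := hlim x (n + 1)
    have hy := hlim y (n + 1)
    rw [PiNat.res_succ] at hx hy
    rw [ih] at hx
    rcases hxn : x n with _ | _ <;> rcases hyn : y n with _ | _
    · rfl
    · rw [hxn] at hx
      rw [hyn] at hy
      exact (hdisj _ _ _ hx _ hy hxy).elim
    · rw [hxn] at hx
      rw [hyn] at hy
      exact (hdisj _ _ _ hy _ hx hxy.symm).elim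
    · rfl

end BaireSchemes

/-! ### Cantor sets avoiding or inside a Menger set -/

section CantorSets

open PiNat (cylinder res)

theorem containsCantorSet_of_continuous_injective {X : Type*} [TopologicalSpace X] [T2Space X]
    {M : Set X} {φ : (ℕ → Bool) → X} (hφ : Continuous φ) (hinj : Function.Injective φ)
    (hM : ∀ x, φ x ∈ M) : ContainsCantorSet M :=
  ⟨range φ, range_subset_iff.2 hM,
    ⟨(hφ.isClosedEmbedding hinj).isEmbedding.toHomeomorph.symm⟩⟩

theorem exists_lt_count_res {x : ℕ → Bool} (hx : ¬ ∃ N, ∀ n ≥ N, x n = false) (m : ℕ) :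
    ∃ k, m < (res x k).count true := by
  push Not at hx
  have succ : ∀ n, x n ≠ false → (res x n).count true < (res x (n + 1)).count true := by
    intro n hn
    rw [PiNat.res_succ, Bool.eq_true_of_not_eq_false hn, List.count_cons_self]
    omega
  induction m with
  | zero =>
    obtain ⟨n, -, hn⟩ := hx 0
    exact ⟨n + 1, (Nat.zero_le _).trans_lt (succ n hn)⟩
  | succ m ih =>
    obtain ⟨k, hk⟩ := ih
    obtain ⟨n, hkn, hn⟩ := hx k
    have hmono : Monotone fun k => (res x k).count true :=
      monotone_nat_of_le_succ fun k => List.count_le_count_cons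
    exact ⟨n + 1, (Nat.succ_le_of_lt hk).trans_lt ((hmono hkn).trans_lt (succ n hn))⟩

/-- The subset of the range of `g` coded by `y`, as a point of the Cantor space. -/
noncomputable def spread (g : ℕ → ℕ) (y : ℕ → Bool) : ℕ → Bool :=
  Function.extend g y fun _ => false

theorem continuous_spread {g : ℕ → ℕ} (hg : Function.Injective g) : Continuous (spread g) := by
  refine continuous_pi fun j => ?_
  by_cases hj : ∃ i, g i = j
  · obtain ⟨i, rfl⟩ := hj
    simpa only [spread, hg.extend_apply] using continuous_apply i
  · simpa only [spread, Function.extend_apply' _ _ _ hj] using continuous_const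

theorem spread_injective {g : ℕ → ℕ} (hg : Function.Injective g) :
    Function.Injective (spread g) :=
  fun y z h => funext fun i => by
    simpa only [spread, hg.extend_apply] using congrFun h (g i)

/-- Only `g 0, …, g (n - 1)` lie below `g n`. -/
theorem count_res_spread_le {g : ℕ → ℕ} (hg : StrictMono g) (y : ℕ → Bool) :
    ∀ k n, k ≤ g n → (res (spread g y) k).count true ≤ n
  | 0, n, _ => by simp
  | k + 1, n, hk => by
    rw [PiNat.res_succ]
    by_cases hj : ∃ i, g i = k
    · obtain ⟨i, rfl⟩ := hj
      have hin : i < n := hg.lt_iff_lt.1 hk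
      have hle := count_res_spread_le hg y (g i) i le_rfl
      rw [List.count_cons]
      split_ifs <;> omega
    · rw [spread, Function.extend_apply' _ _ _ hj, List.count_cons_of_ne (by simp)]
      exact count_res_spread_le hg y k n (by omega)

/-- If a Menger subset of a space avoids the finitely supported points of a Cantor set, then it
avoids a smaller Cantor set. -/
theorem IsMengerSpace.exists_continuous_injective_notMem {X : Type*} [TopologicalSpace X]
    [T2Space X] {M : Set X} (hM : IsMengerSpace M) {φ : (ℕ → Bool) → X} (hφ : Continuous φ)
    (hinj : Function.Injective φ) (hfin : ∀ x, (∃ N, ∀ n ≥ N, x n = false) → φ x ∉ M) :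
    ∃ ψ : (ℕ → Bool) → X, Continuous ψ ∧ Function.Injective ψ ∧ ∀ x, ψ x ∉ M := by
  have hcl : ∀ n k, IsClosed {x : ℕ → Bool | (res x k).count true ≤ n} := fun n k =>
    isClosed_Iic.preimage (continuous_comp_res (fun s : List Bool => s.count true) k)
  -- These sets cover `M` because its points on the Cantor set have infinitely many ones; sets of
  -- ones inside `range g` are too sparse to be caught.
  obtain ⟨g, hg, h⟩ := hM.exists_strictMono
    (fun n k => Subtype.val ⁻¹' (φ '' {x | (res x k).count true ≤ n})ᶜ)
    (fun n k => ((hcl n k).isCompact.image hφ).isClosed.isOpen_compl.preimage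
      continuous_subtype_val)
    (fun n => monotone_nat_of_le_succ fun k => by
      refine preimage_mono (compl_subset_compl.2 (image_mono fun x hx => ?_))
      exact List.count_le_count_cons.trans hx)
    (fun n m => by
      by_cases hm : ∃ x, φ x = m
      · obtain ⟨x, hx⟩ := hm
        obtain ⟨k, hk⟩ := exists_lt_count_res (x := x)
          (fun hf => hfin x hf (hx ▸ m.2)) n
        refine ⟨k, ?_⟩
        rintro ⟨y, hy, hym⟩
        obtain rfl := hinj (hym.trans hx.symm)
        exact hk.not_ge hy
      · exact ⟨0, fun ⟨x, _, hx⟩ => hm ⟨x, hx⟩⟩)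
  refine ⟨φ ∘ spread g, hφ.comp (continuous_spread hg.injective),
    hinj.comp (spread_injective hg.injective), fun x hx => ?_⟩
  obtain ⟨n, hn⟩ := h ⟨_, hx⟩
  exact hn ⟨_, count_res_spread_le hg x _ n le_rfl, rfl⟩

/-- The Cantor space has a continuous injective self-map sending the finitely supported points
into a given dense set. -/
theorem exists_continuous_injective_mapsTo_of_dense {D : Set (ℕ → Bool)}
    (hD : ∀ x n, ∃ d ∈ D, d ∈ cylinder x n) :
    ∃ φ : (ℕ → Bool) → (ℕ → Bool), Continuous φ ∧ Function.Injective φ ∧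
      ∀ x, (∃ N, ∀ n ≥ N, x n = false) → φ x ∈ D := by
  have step : ∀ (d : D) (n : ℕ), ∃ e : D, e.1 ∈ cylinder d.1 n ∧ e.1 n = !d.1 n := by
    intro d n
    obtain ⟨e, heD, he⟩ := hD (Function.update d.1 n (!d.1 n)) (n + 1)
    refine ⟨⟨e, heD⟩, fun i hi => ?_, ?_⟩
    · exact (he i (hi.trans n.lt_succ_self)).trans (Function.update_of_ne hi.ne _ _)
    · exact (he n n.lt_succ_self).trans (Function.update_self _ _ _)
  choose e he hen using step
  obtain ⟨d₀, hd₀, -⟩ := hD (fun _ => false) 0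
  -- The bit `false` keeps the current point of `D`, `true` moves to one differing at the current
  -- coordinate. A finitely supported branch is thus eventually constant, with limit in `D`.
  let st : List Bool → D := fun s =>
    List.rec ⟨d₀, hd₀⟩ (fun b s d => cond b (e d s.length) d) s
  have hcyl : ∀ b s, (st (b :: s)).1 ∈ cylinder (st s).1 s.length := by
    rintro (_ | _) s
    exacts [PiNat.self_mem_cylinder _ _, he _ _]
  have hxor : ∀ b s, (st (b :: s)).1 s.length = ((st s).1 s.length ^^ b) := by
    rintro (_ | _) s
    · exact (Bool.xor_false _).symm
    · exact (hen _ _).trans (Bool.xor_true _).symm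
  have hlim : ∀ (x : ℕ → Bool) m,
      (fun i => (st (res x (i + 1))).1 i) ∈ cylinder (st (res x m)).1 m := fun x m =>
    diag_mem_cylinder (z := fun m => (st (res x m)).1) (l := id) strictMono_id
      (fun m => by simpa only [PiNat.res_length, PiNat.res_succ, id] using hcyl (x m) (res x m)) m
  refine ⟨fun x i => (st (res x (i + 1))).1 i,
    continuous_pi fun i => continuous_comp_res (fun s => (st s).1 i) (i + 1), ?_, ?_⟩
  · intro x y hxy
    refine PiNat.res_injective (funext fun n => ?_)
    induction n with
    | zero => rfl
    | succ n ih =>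
      have h : (st (res x (n + 1))).1 n = (st (res y (n + 1))).1 n := congrFun hxy n
      have hx := hxor (x n) (res x n)
      have hy := hxor (y n) (res y n)
      rw [PiNat.res_length] at hx hy
      rw [PiNat.res_succ, PiNat.res_succ, hx, hy, ih, Bool.xor_right_inj] at h
      rw [PiNat.res_succ, PiNat.res_succ, ih, h]
  · rintro x ⟨N, hN⟩
    have hconst : ∀ n ≥ N, st (res x n) = st (res x N) := by
      intro n hn
      induction n, hn using Nat.le_induction with
      | base => rfl
      | succ n hn ih =>
        rw [PiNat.res_succ, hN n hn]
        exact ih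
    have : (fun i => (st (res x (i + 1))).1 i) = (st (res x N)).1 := by
      funext i
      have := hlim x (max N (i + 1)) i (by omega)
      rwa [hconst _ (le_max_left _ _)] at this
    exact this.symm.subst (motive := (· ∈ D)) (st (res x N)).2

theorem containsCantorSet_of_cylinder {X : Type*} [TopologicalSpace X] [T2Space X] {M : Set X}
    {φ : (ℕ → Bool) → X} (hφ : Continuous φ) (hinj : Function.Injective φ) (x : ℕ → Bool) (n : ℕ)
    (hM : ∀ y ∈ cylinder x n, φ y ∈ M) : ContainsCantorSet M := by
  refine containsCantorSet_of_continuous_injective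
    (φ := fun y => φ fun i => if i < n then x i else y (i - n)) (hφ.comp ?_) ?_ fun y => hM _ ?_
  · refine continuous_pi fun i => ?_
    split_ifs
    exacts [continuous_const, continuous_apply _]
  · intro y z h
    funext i
    simpa using congrFun (hinj h) (i + n)
  · intro i hi
    exact if_pos hi

end CantorSets

/-! ### The main theorem -/

theorem mainTheorem8 {G : Type*} [Group G] [TopologicalSpace G] [IsTopologicalGroup G]
    [T2Space G] (hG : IsAnalyticSpace G) (M : Set G) (hMne : M.Nonempty)
    (hM : IsMengerSpace M) (hsub : ∃ H : Subgroup G, (H : Set G) = Mᶜ) :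
    SigmaCompactSpace G ∧ (Uncountable G → ContainsCantorSet M) := by
  obtain ⟨H, hH⟩ := hsub
  obtain ⟨a, ha⟩ := hMne
  have mem_H : ∀ x, x ∈ H ↔ x ∉ M := fun x => by rw [← SetLike.mem_coe, hH, mem_compl_iff]
  have mul_mem : ∀ x, x ∉ M → a * x ∈ M := by
    intro x hx
    by_contra h
    exact (mem_H a).1 ((H.mul_mem_cancel_right ((mem_H x).2 hx)).1 ((mem_H _).2 h)) ha
  obtain ⟨f, hf, hrange⟩ : ∃ f : (ℕ → ℕ) → G, Continuous f ∧ range f = univ := by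
    rw [IsAnalyticSpace, MeasureTheory.AnalyticSet] at hG
    exact hG.resolve_left univ_nonempty.ne_empty
  refine ⟨?_, fun hunc => ?_⟩
  · have hGM : IsMengerSpace G := hM.of_range_union_range_eq_univ continuous_subtype_val
      (continuous_subtype_val.const_mul a⁻¹) (eq_univ_iff_forall.2 fun x => by
        by_cases hx : x ∈ M
        · exact Or.inl ⟨⟨x, hx⟩, rfl⟩
        · exact Or.inr ⟨⟨a * x, mul_mem x hx⟩, inv_mul_cancel_left a x⟩)
    exact hGM.sigmaCompactSpace hf hrange
  · obtain ⟨κ, hκ, hκi⟩ := exists_continuous_injective_of_not_countable_range hf (by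
      rw [hrange]
      exact not_countable_univ)
    by_cases hD : ∀ x n, ∃ d ∈ {d | κ d ∉ M}, d ∈ PiNat.cylinder x n
    · obtain ⟨φ, hφ, hφi, hφD⟩ := exists_continuous_injective_mapsTo_of_dense hD
      obtain ⟨ψ, hψ, hψi, hψM⟩ :=
        hM.exists_continuous_injective_notMem (hκ.comp hφ) (hκi.comp hφi) hφD
      exact containsCantorSet_of_continuous_injective (hψ.const_mul a)
        ((mul_right_injective a).comp hψi) fun x => mul_mem _ (hψM x)
    · push Not at hD
      obtain ⟨x, n, hx⟩ := hD
      exact containsCantorSet_of_cylinder hκ hκi x n fun y hy => by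
        by_contra hyM
        exact hx y hyM hy
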